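/- For a Lebesgue measurable set $F\subseteq\mathbb R^2$ let $\operatorname{Per}(F)=\sup\{\int_F\operatorname{div}z\,dx : z\in C_c^\infty(\mathbb R^2;\mathbb R^2),\ |z|\le 1\}$. An integrable function $\kappa$ on $\mathbb R^2$ is a variational mean curvature of a set $E$ of finite perimeter if $E$ minimizes $F\mapsto\operatorname{Per}(F)-\int_F\kappa$ among all sets $F$ of finite perimeter. For $E\subseteq\mathbb R^2$ and $h\in L^1(\mathbb R^2)$ with $h>0$, let $(E_\lambda)_{\lambda>0}$ be minimizers of $F\mapsto\operatorname{Per}(F)-\lambda\int_F h$ among sets of finite perimeter $F\subseteq E$, with representatives chosen such that $E_\lambda\subseteq E_\mu$ for $\lambda<\mu$, and let $(E^c_\lambda)_{\lambda>0}$ be such a family for the complement $E^c$. An optimal curvature of $E$ with density $h$ is a function $\kappa_E$ which is almost everywhere given by $$\kappa_E(x)=\inf\{\lambda h(x) : \lambda>0,\ x\in E_\lambda\}\ (x\in E),\qquad \kappa_E(x)=-\inf\{\lambda h(x) : \lambda>0,\ x\in E^c_\lambda\}\ (x\in E^c).$$ Let $0\le r_1<r_2$ and let $\mathcal A=B(0,r_2)\setminus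 B(0,r_1)\subset\mathbb R^2$. Then $\mathcal A$ has an optimal curvature whose density $h$ equals $1$ on $\mathcal A$ and which is a variational mean curvature of $\mathcal A$ with least $L^1(\mathbb R^2)$ norm among all variational mean curvatures of $\mathcal A$. Moreover, every optimal curvature $\kappa_{\mathcal A}$ of $\mathcal A$ whose density $h$ equals $1$ on $\mathcal A$ is constant almost everywhere on $\mathcal A$, with $$\kappa_{\mathcal A}=\frac{2(r_1+r_2)}{r_2^2-r_1^2}\quad\text{a.e. on }\mathcal A.$$ -/

import Mathlib

open MeasureTheory Set
open scoped ContDiff ENNReal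

noncomputable section

namespace VarCurv

/-- The divergence of a vector field on `ℝ^d`. -/
def divergence {d : ℕ} (z : EuclideanSpace ℝ (Fin d) → EuclideanSpace ℝ (Fin d))
    (x : EuclideanSpace ℝ (Fin d)) : ℝ :=
  ∑ i, fderiv ℝ z x (EuclideanSpace.single i 1) i

/-- Smooth compactly supported vector fields on `ℝ^d` with sup norm (for the Euclidean norm on the
values) at most one. -/
def testFields (d : ℕ) : Set (EuclideanSpace ℝ (Fin d) → EuclideanSpace ℝ (Fin d)) :=
  {z | ContDiff ℝ ∞ z ∧ HasCompactSupport z ∧ ∀ x, ‖z x‖ ≤ 1}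

/-- The total variation `sup {∫ u div z}` over the test fields. As `testFields` is stable under
`z ↦ -z`, cutting off negative values by `ENNReal.ofReal` does not change the supremum. -/
def totalVariation {d : ℕ} (u : EuclideanSpace ℝ (Fin d) → ℝ) : ℝ≥0∞ :=
  ⨆ z ∈ testFields d, ENNReal.ofReal (∫ x, u x * divergence z x)

/-- The perimeter of a set, with value `∞` for sets that are not of finite perimeter. -/
def perimeter {d : ℕ} (E : Set (EuclideanSpace ℝ (Fin d))) : ℝ≥0∞ :=
  totalVariation (E.indicator fun _ => 1)

/-- Measurable sets of finite perimeter. -/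
def FinitePerimeter {d : ℕ} (E : Set (EuclideanSpace ℝ (Fin d))) : Prop :=
  MeasurableSet E ∧ perimeter E < ⊤

/-- The functional `F ↦ Per F - ∫_F g`, used on sets of finite perimeter and for integrable `g`. -/
def energy {d : ℕ} (g : EuclideanSpace ℝ (Fin d) → ℝ) (F : Set (EuclideanSpace ℝ (Fin d))) : ℝ :=
  (perimeter F).toReal - ∫ x in F, g x

/-- `M` minimizes `F ↦ Per F - ∫_F g` among the subsets `F` of `E`. (Sets of infinite perimeter have
infinite energy and need not be tested, `g` being integrable.) -/
structure IsMinimizerIn {d : ℕ} (g : EuclideanSpace ℝ (Fin d) → ℝ)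
    (E M : Set (EuclideanSpace ℝ (Fin d))) : Prop where
  subset : M ⊆ E
  finitePerimeter : FinitePerimeter M
  le : ∀ F, F ⊆ E → FinitePerimeter F → energy g M ≤ energy g F

/-- `κ ∈ L¹(ℝ^d)` is a variational mean curvature of `E`. -/
def IsVariationalCurvature {d : ℕ} (E : Set (EuclideanSpace ℝ (Fin d)))
    (κ : EuclideanSpace ℝ (Fin d) → ℝ) : Prop :=
  Integrable κ ∧ IsMinimizerIn κ univ E

/-- A family `(S l)`, `l > 0`, of minimizers of `F ↦ Per F - l ∫_F h` among the subsets of `E`.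
Minimizers are determined only up to null sets, and are nested up to null sets; the
representatives are taken such that they are nested. -/
structure IsMinimizerFamily {d : ℕ} (h : EuclideanSpace ℝ (Fin d) → ℝ)
    (E : Set (EuclideanSpace ℝ (Fin d))) (S : ℝ → Set (EuclideanSpace ℝ (Fin d))) : Prop where
  minimizes : ∀ l, 0 < l → IsMinimizerIn (fun x => l * h x) E (S l)
  nested : ∀ l m, 0 < l → l < m → S l ⊆ S m

/-- The function `x ↦ inf {l h(x) | l > 0, x ∈ S l}`. -/
def levelCurvature {d : ℕ} (h : EuclideanSpace ℝ (Fin d) → ℝ)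
    (S : ℝ → Set (EuclideanSpace ℝ (Fin d))) (x : EuclideanSpace ℝ (Fin d)) : ℝ :=
  sInf {t | ∃ l, 0 < l ∧ x ∈ S l ∧ t = l * h x}

/-- Densities: positive functions in `L¹(ℝ^d)`. -/
def IsDensity {d : ℕ} (h : EuclideanSpace ℝ (Fin d) → ℝ) : Prop :=
  Integrable h ∧ ∀ᵐ x, 0 < h x

/-- `κ` is the optimal curvature of `E` built with the density `h`: on `E` it is the level curvature
of `E`, outside of `E` it is minus the level curvature of the complement of `E`. -/
structure IsOptimalCurvature {d : ℕ} (h : EuclideanSpace ℝ (Fin d) → ℝ)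
    (E : Set (EuclideanSpace ℝ (Fin d))) (κ : EuclideanSpace ℝ (Fin d) → ℝ) : Prop where
  inside : ∃ S, IsMinimizerFamily h E S ∧
    ∀ᵐ x ∂(volume.restrict E), κ x = levelCurvature h S x
  outside : ∃ S, IsMinimizerFamily h Eᶜ S ∧
    ∀ᵐ x ∂(volume.restrict Eᶜ), κ x = -levelCurvature h S x

/-- The planar annulus `B(0, r₂) \ B(0, r₁)`. -/
def annulus (r₁ r₂ : ℝ) : Set (EuclideanSpace ℝ (Fin 2)) :=
  Metric.ball 0 r₂ \ Metric.ball 0 r₁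

end VarCurv

end

/-!
A set `E` is calibrated by a field `v` with `|v| ≤ 1` which equals the outer normal on the boundary
of `E`: for every `F` one has `|∫_F div v| ≤ Per F`, with equality at `F = E`. Hence `div v` is a
variational mean curvature of `E`. If it is positive on `E` and negative outside, its `L¹` norm is
`2 Per E`, and testing the minimality of `E` against `∅` and the whole space shows that no
variational mean curvature has a smaller one. If moreover `div v = c` on `E`, then `E` minimizes
`Per F / ∫_F h` among its subsets for every density `h` which is one on `E`. So the minimizers of
`Per F - l ∫_F h` in `E` are null for `l < c` and full for `l > c`, and the level curvature is `c`.

For a spherical shell in `ℝ^d` such a field is radial, with radial component `α r - K r ^ (1 - d)`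
on the shell, where `α` and `K` are determined by the boundary values `-1` and `1`; this gives
`c = d α`. It is continued by `-x / r₁` inside and by a decaying field outside. Test fields being
smooth with compact support, the calibration inequality is transferred to this field by
mollification and cutoff.
-/

noncomputable section

open Filter Topology Metric
open scoped NNReal Convolution

namespace VarCurv

section Divergence

variable {d : ℕ} {u : EuclideanSpace ℝ (Fin d) → ℝ}
  {v w : EuclideanSpace ℝ (Fin d) → EuclideanSpace ℝ (Fin d)} {x : EuclideanSpace ℝ (Fin d)}
  {C D M N : ℝ≥0}

variable (d) in
/-- The trace of endomorphisms of `ℝ^d` as a continuous linear functional. It gives access to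
`divergence v x = tr (Dv x)` without choosing coordinates. -/
def traceCLM : (EuclideanSpace ℝ (Fin d) →L[ℝ] EuclideanSpace ℝ (Fin d)) →L[ℝ] ℝ :=
  ∑ i, (EuclideanSpace.proj i).comp
    (ContinuousLinearMap.apply ℝ (EuclideanSpace ℝ (Fin d)) (EuclideanSpace.single i 1))

lemma divergence_eq_traceCLM (v : EuclideanSpace ℝ (Fin d) → EuclideanSpace ℝ (Fin d))
    (x : EuclideanSpace ℝ (Fin d)) : divergence v x = traceCLM d (fderiv ℝ v x) := by
  simp [divergence, traceCLM]

lemma traceCLM_id : traceCLM d (.id ℝ _) = d := by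
  simp [traceCLM]

lemma traceCLM_smulRight (φ : EuclideanSpace ℝ (Fin d) →L[ℝ] ℝ) (y : EuclideanSpace ℝ (Fin d)) :
    traceCLM d (φ.smulRight y) = φ y := by
  conv_rhs => rw [← (EuclideanSpace.basisFun (Fin d) ℝ).sum_repr y]
  simp [traceCLM, mul_comm]

lemma divergence_congr (h : v =ᶠ[𝓝 x] w) : divergence v x = divergence w x := by
  rw [divergence_eq_traceCLM, divergence_eq_traceCLM, h.fderiv_eq]

lemma divergence_neg (v : EuclideanSpace ℝ (Fin d) → EuclideanSpace ℝ (Fin d))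
    (x : EuclideanSpace ℝ (Fin d)) : divergence (-v) x = -divergence v x := by
  simp [divergence_eq_traceCLM, fderiv_neg]

lemma divergence_smul (hu : DifferentiableAt ℝ u x) (hv : DifferentiableAt ℝ v x) :
    divergence (u • v) x = u x * divergence v x + fderiv ℝ u x (v x) := by
  rw [divergence_eq_traceCLM, fderiv_smul hu hv, map_add, map_smul, traceCLM_smulRight,
    divergence_eq_traceCLM, smul_eq_mul]

lemma measurable_divergence : Measurable (divergence v) := by
  simp only [funext (divergence_eq_traceCLM v)]
  exact (traceCLM d).measurable.comp (measurable_fderiv ℝ v)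

lemma norm_divergence_le (hv : LipschitzWith C v) (x : EuclideanSpace ℝ (Fin d)) :
    ‖divergence v x‖ ≤ ‖traceCLM d‖ * C := by
  rw [divergence_eq_traceCLM]
  exact (traceCLM d).le_opNorm_of_le (norm_fderiv_le_of_lipschitz ℝ hv)

lemma support_divergence_subset : Function.support (divergence v) ⊆ tsupport v := fun x hx => by
  by_contra hxv
  exact hx (by rw [divergence_eq_traceCLM, fderiv_of_notMem_tsupport ℝ hxv, map_zero])

lemma integrable_divergence (hv : LipschitzWith C v) (hvs : HasCompactSupport v) :
    Integrable (divergence v) := by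
  rw [← integrableOn_iff_integrable_of_support_subset support_divergence_subset]
  exact Measure.integrableOn_of_bounded hvs.measure_lt_top.ne
    measurable_divergence.aestronglyMeasurable (.of_forall (norm_divergence_le hv))

section LineDeriv

variable {V : Type*} [NormedAddCommGroup V] [NormedSpace ℝ V] [FiniteDimensional ℝ V]
  [MeasurableSpace V] [BorelSpace V] (μ : Measure V) [μ.IsAddHaarMeasure] {f : V → ℝ}

lemma integrable_lineDeriv (hf : LipschitzWith C f) (hfs : HasCompactSupport f) (y : V) :
    Integrable (fun x => lineDeriv ℝ f x y) μ := by
  refine ((hf.locallyIntegrable_lineDeriv y).integrableOn_isCompact hfs)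
    |>.integrable_of_forall_notMem_eq_zero fun x hx => ?_
  rw [(notMem_tsupport_iff_eventuallyEq.1 hx).lineDeriv_eq]
  simp [lineDeriv]

lemma integral_lineDeriv_eq_zero (hf : LipschitzWith C f) (hfs : HasCompactSupport f) (y : V) :
    ∫ x, lineDeriv ℝ f x y ∂μ = 0 := by
  have := (LipschitzWith.const (1 : ℝ)).integral_lineDeriv_mul_eq (μ := μ) hf hfs (-y)
  simpa [lineDeriv] using this.symm

end LineDeriv

lemma integral_divergence_eq_zero (hv : LipschitzWith C v) (hvs : HasCompactSupport v) :
    ∫ x, divergence v x = 0 := by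
  have lipschitz_coord (i : Fin d) : LipschitzWith C fun x => v x i := .of_dist_le_mul fun x y => by
    simpa [dist_eq_norm] using (PiLp.norm_apply_le (v x - v y) i).trans (hv.norm_sub_le x y)
  have compact_coord (i : Fin d) : HasCompactSupport fun x => v x i :=
    hvs.comp_left (g := fun y : EuclideanSpace ℝ (Fin d) => y i) rfl
  calc ∫ x, divergence v x
      = ∫ x, ∑ i, lineDeriv ℝ (fun x => v x i) x (EuclideanSpace.single i 1) := by
        refine integral_congr_ae ?_
        filter_upwards [hv.ae_differentiableAt] with x hx
        refine Finset.sum_congr rfl fun i _ => ?_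
        have hasFDerivAt_coord := (EuclideanSpace.proj (𝕜 := ℝ) i).hasFDerivAt.comp x hx.hasFDerivAt
        exact (hasFDerivAt_coord.hasLineDerivAt _).lineDeriv.symm
    _ = ∑ i, ∫ x, lineDeriv ℝ (fun x => v x i) x (EuclideanSpace.single i 1) :=
        integral_finsetSum _ fun i _ =>
          integrable_lineDeriv volume (lipschitz_coord i) (compact_coord i) _
    _ = 0 := Finset.sum_eq_zero fun i _ =>
        integral_lineDeriv_eq_zero volume (lipschitz_coord i) (compact_coord i) _

lemma lipschitzWith_smul_of_norm_le {α W : Type*} [PseudoMetricSpace α] [SeminormedAddCommGroup W]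
    [NormedSpace ℝ W] {f : α → ℝ} {g : α → W} (hf : LipschitzWith C f) (hfM : ∀ x, ‖f x‖ ≤ M)
    (hg : LipschitzWith D g) (hgN : ∀ x, ‖g x‖ ≤ N) : LipschitzWith (M * D + C * N) (f • g) := by
  refine .of_dist_le_mul fun x y => ?_
  calc dist (f x • g x) (f y • g y)
      = ‖f x • (g x - g y) + (f x - f y) • g y‖ := by rw [dist_eq_norm]; congr 1; module
    _ ≤ ‖f x‖ * ‖g x - g y‖ + ‖f x - f y‖ * ‖g y‖ := by
        simpa only [norm_smul] using norm_add_le (f x • (g x - g y)) ((f x - f y) • g y)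
    _ ≤ M * (D * dist x y) + C * dist x y * N := by
        rw [← dist_eq_norm, ← dist_eq_norm]
        gcongr
        exacts [hfM x, hg.dist_le_mul x y, hf.dist_le_mul x y, hgN y]
    _ = (M * D + C * N : ℝ≥0) * dist x y := by push_cast; ring

lemma integral_mul_divergence (hu : LipschitzWith C u) (huM : ∀ x, ‖u x‖ ≤ M)
    (hv : LipschitzWith D v) (hvs : HasCompactSupport v) :
    ∫ x, u x * divergence v x = -∫ x, fderiv ℝ u x (v x) := by
  obtain ⟨N, hN⟩ := hvs.exists_bound_of_continuous hv.continuous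
  have huv : LipschitzWith (M * D + C * N.toNNReal) (u • v) :=
    lipschitzWith_smul_of_norm_le hu huM hv fun x => (hN x).trans (Real.le_coe_toNNReal N)
  have hint : Integrable fun x => u x * divergence v x :=
    (integrable_divergence hv hvs).bdd_mul hu.continuous.aestronglyMeasurable (.of_forall huM)
  have product_rule : divergence (u • v) =ᵐ[volume]
      fun x => u x * divergence v x + fderiv ℝ u x (v x) := by
    filter_upwards [hu.ae_differentiableAt, hv.ae_differentiableAt] with x hux hvx
    exact divergence_smul hux hvx
  have hint' : Integrable fun x => fderiv ℝ u x (v x) := by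
    refine ((integrable_divergence huv hvs.smul_left).sub hint).congr ?_
    filter_upwards [product_rule] with x hx
    simp [hx]
  rw [← add_eq_zero_iff_eq_neg, ← integral_add hint hint', ← integral_congr_ae product_rule]
  exact integral_divergence_eq_zero huv hvs.smul_left

end Divergence

section Perimeter

variable {d : ℕ} {z : EuclideanSpace ℝ (Fin d) → EuclideanSpace ℝ (Fin d)}
  {A B E : Set (EuclideanSpace ℝ (Fin d))}

lemma neg_mem_testFields (hz : z ∈ testFields d) : -z ∈ testFields d :=
  ⟨hz.1.neg, hz.2.1.neg, fun x => by simpa using hz.2.2 x⟩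

lemma exists_lipschitzWith_of_mem_testFields (hz : z ∈ testFields d) : ∃ C, LipschitzWith C z :=
  hz.1.lipschitzWith_of_hasCompactSupport hz.2.1 (by simp)

lemma integrable_divergence_of_mem_testFields (hz : z ∈ testFields d) :
    Integrable (divergence z) :=
  let ⟨_, hC⟩ := exists_lipschitzWith_of_mem_testFields hz
  integrable_divergence hC hz.2.1

lemma integral_indicator_mul_divergence (hE : MeasurableSet E) :
    ∫ x, E.indicator (fun _ => (1 : ℝ)) x * divergence z x = ∫ x in E, divergence z x := by
  simp [← integral_indicator hE, ← indicator_mul_left]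

lemma le_perimeter (hE : MeasurableSet E) (hz : z ∈ testFields d) :
    ENNReal.ofReal (∫ x in E, divergence z x) ≤ perimeter E := by
  rw [← integral_indicator_mul_divergence hE]
  exact le_iSup₂ (f := fun z (_ : z ∈ testFields d) =>
    ENNReal.ofReal (∫ x, E.indicator (fun _ => (1 : ℝ)) x * divergence z x)) z hz

lemma perimeter_le (hE : MeasurableSet E) {c : ℝ≥0∞}
    (h : ∀ z ∈ testFields d, ENNReal.ofReal (∫ x in E, divergence z x) ≤ c) : perimeter E ≤ c :=
  iSup₂_le fun z hz => by
    rw [integral_indicator_mul_divergence hE]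
    exact h z hz

lemma perimeter_sdiff_le (hA : MeasurableSet A) (hB : MeasurableSet B) (hBA : B ⊆ A) :
    perimeter (A \ B) ≤ perimeter A + perimeter B := by
  refine perimeter_le (hA.diff hB) fun z hz => ?_
  have hint : IntegrableOn (divergence z) A :=
    (integrable_divergence_of_mem_testFields hz).integrableOn
  calc ENNReal.ofReal (∫ x in A \ B, divergence z x)
      = ENNReal.ofReal ((∫ x in A, divergence z x) + ∫ x in B, divergence (-z) x) := by
        simp [setIntegral_sdiff hB hint hBA, divergence_neg, integral_neg, sub_eq_add_neg]
    _ ≤ _ := ENNReal.ofReal_add_le.trans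
        (add_le_add (le_perimeter hA hz) (le_perimeter hB (neg_mem_testFields hz)))

@[simp] lemma perimeter_empty : perimeter (∅ : Set (EuclideanSpace ℝ (Fin d))) = 0 := by
  simp [perimeter, totalVariation]

@[simp] lemma perimeter_univ : perimeter (univ : Set (EuclideanSpace ℝ (Fin d))) = 0 := by
  refine le_antisymm (perimeter_le .univ fun z hz => ?_) bot_le
  obtain ⟨C, hC⟩ := exists_lipschitzWith_of_mem_testFields hz
  simp [integral_divergence_eq_zero hC hz.2.1]

lemma perimeter_compl (hE : MeasurableSet E) : perimeter Eᶜ = perimeter E := by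
  have compl_le {F : Set (EuclideanSpace ℝ (Fin d))} (hF : MeasurableSet F) :
      perimeter Fᶜ ≤ perimeter F := by
    simpa [compl_eq_univ_sdiff] using perimeter_sdiff_le .univ hF (subset_univ F)
  exact (compl_le hE).antisymm (by simpa using compl_le hE.compl)

lemma finitePerimeter_empty : FinitePerimeter (∅ : Set (EuclideanSpace ℝ (Fin d))) :=
  ⟨.empty, by simp⟩

lemma finitePerimeter_univ : FinitePerimeter (univ : Set (EuclideanSpace ℝ (Fin d))) :=
  ⟨.univ, by simp⟩

lemma finitePerimeter_compl (hE : FinitePerimeter E) : FinitePerimeter Eᶜ :=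
  ⟨hE.1.compl, (perimeter_compl hE.1).trans_lt hE.2⟩

end Perimeter

section MinkowskiContent

lemma lipschitzWith_coe_thickenedIndicator {α : Type*} [PseudoEMetricSpace α] {ε : ℝ} (hε : 0 < ε)
    (A : Set α) : LipschitzWith ε.toNNReal⁻¹ fun x => (thickenedIndicator hε A x : ℝ) :=
  lipschitzWith_thickenedIndicator hε A

lemma norm_coe_thickenedIndicator_le_one {α : Type*} [PseudoEMetricSpace α] {ε : ℝ} (hε : 0 < ε)
    (A : Set α) (x : α) : ‖(thickenedIndicator hε A x : ℝ)‖ ≤ 1 := by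
  simpa using thickenedIndicator_le_one hε A x

lemma norm_fderiv_thickenedIndicator_le {V : Type*} [NormedAddCommGroup V] [NormedSpace ℝ V]
    {ε : ℝ} (hε : 0 < ε) (A : Set V) (x : V) :
    ‖fderiv ℝ (fun y => (thickenedIndicator hε A y : ℝ)) x‖
      ≤ (thickening ε A \ A).indicator (fun _ => ε⁻¹) x := by
  by_cases hx : x ∈ thickening ε A \ A
  · simpa [indicator_of_mem hx, hε.le] using
      norm_fderiv_le_of_lipschitz ℝ (lipschitzWith_coe_thickenedIndicator hε A) (x₀ := x)
  rw [indicator_of_notMem hx, norm_le_zero_iff]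
  by_cases hxA : x ∈ A
  · refine IsLocalMax.fderiv_eq_zero (.of_forall fun y => ?_)
    simpa only [thickenedIndicator_one hε A hxA] using
      NNReal.coe_le_coe.2 (thickenedIndicator_le_one hε A y)
  · refine IsLocalMin.fderiv_eq_zero (.of_forall fun y => ?_)
    simp [thickenedIndicator_zero hε A fun h => hx ⟨h, hxA⟩]

variable {d : ℕ} {z : EuclideanSpace ℝ (Fin d) → EuclideanSpace ℝ (Fin d)}
  {A : Set (EuclideanSpace ℝ (Fin d))}

lemma ofReal_integral_thickenedIndicator_mul_divergence_le {ε : ℝ} (hε : 0 < ε)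
    (hA : MeasurableSet A) (hz : z ∈ testFields d) :
    ENNReal.ofReal (∫ x, (thickenedIndicator hε A x : ℝ) * divergence z x)
      ≤ volume (thickening ε A \ A) / ENNReal.ofReal ε := by
  obtain ⟨D, hD⟩ := exists_lipschitzWith_of_mem_testFields hz
  have hmeas : MeasurableSet (thickening ε A \ A) := isOpen_thickening.measurableSet.diff hA
  have bound (x) : ‖fderiv ℝ (fun y => (thickenedIndicator hε A y : ℝ)) x (z x)‖ₑ
      ≤ (thickening ε A \ A).indicator (fun _ => (ENNReal.ofReal ε)⁻¹) x := by
    have norm_le := (ContinuousLinearMap.le_opNorm _ (z x)).trans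
      (mul_le_mul (norm_fderiv_thickenedIndicator_le hε A x) (hz.2.2 x) (norm_nonneg _)
        (indicator_nonneg (fun _ _ => by positivity) _))
    rw [mul_one] at norm_le
    rw [← ofReal_norm, ← ENNReal.ofReal_inv_of_pos hε]
    refine (ENNReal.ofReal_le_ofReal norm_le).trans_eq ?_
    by_cases hx : x ∈ thickening ε A \ A <;> simp [hx]
  rw [integral_mul_divergence (lipschitzWith_coe_thickenedIndicator hε A)
    (norm_coe_thickenedIndicator_le_one hε A) (M := 1) hD hz.2.1]
  calc ENNReal.ofReal (-∫ x, fderiv ℝ (fun y => (thickenedIndicator hε A y : ℝ)) x (z x))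
      ≤ ∫⁻ x, ‖fderiv ℝ (fun y => (thickenedIndicator hε A y : ℝ)) x (z x)‖ₑ :=
        (Real.ofReal_le_enorm _).trans (by
          rw [enorm_neg]; exact enorm_integral_le_lintegral_enorm _)
    _ ≤ ∫⁻ x, (thickening ε A \ A).indicator (fun _ => (ENNReal.ofReal ε)⁻¹) x :=
        lintegral_mono bound
    _ = volume (thickening ε A \ A) / ENNReal.ofReal ε := by
        rw [lintegral_indicator_const hmeas, mul_comm, div_eq_mul_inv]

lemma tendsto_integral_thickenedIndicator_mul {g : EuclideanSpace ℝ (Fin d) → ℝ}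
    (hg : Integrable g) {δ : ℕ → ℝ} (hδ : ∀ n, 0 < δ n) (hδ0 : Tendsto δ atTop (𝓝 0)) :
    Tendsto (fun n => ∫ x, (thickenedIndicator (hδ n) A x : ℝ) * g x) atTop
      (𝓝 (∫ x in closure A, g x)) := by
  rw [← integral_indicator isClosed_closure.measurableSet]
  refine tendsto_integral_of_dominated_convergence (fun x => ‖g x‖) (fun n => ?_) hg.norm
    (fun n => .of_forall fun x => ?_) (.of_forall fun x => ?_)
  · exact (NNReal.continuous_coe.comp (thickenedIndicator (hδ n) A).continuous)
      |>.aestronglyMeasurable.mul hg.aestronglyMeasurable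
  · rw [norm_mul]
    exact mul_le_of_le_one_left (norm_nonneg _) (norm_coe_thickenedIndicator_le_one (hδ n) A x)
  · have lim := tendsto_pi_nhds.1 (thickenedIndicator_tendsto_indicator_closure hδ hδ0 A) x
    convert (NNReal.tendsto_coe.2 lim).mul_const (g x) using 2
    by_cases hx : x ∈ closure A <;> simp [hx]

theorem perimeter_le_liminf_volume_thickening (hA : MeasurableSet A)
    (hcl : volume (closure A \ A) = 0) {δ : ℕ → ℝ} (hδ : ∀ n, 0 < δ n)
    (hδ0 : Tendsto δ atTop (𝓝 0)) :
    perimeter A ≤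
      liminf (fun n => volume (thickening (δ n) A \ A) / ENNReal.ofReal (δ n)) atTop := by
  refine perimeter_le hA fun z hz => ?_
  have ae_eq_closure : A =ᵐ[volume] closure A :=
    subset_closure.eventuallyLE.antisymm (ae_le_set.2 hcl)
  have lim := ENNReal.tendsto_ofReal (tendsto_integral_thickenedIndicator_mul (A := A)
    (integrable_divergence_of_mem_testFields hz) hδ hδ0)
  rw [setIntegral_congr_set ae_eq_closure, ← lim.liminf_eq]
  exact liminf_le_liminf (.of_forall fun n =>
    ofReal_integral_thickenedIndicator_mul_divergence_le (hδ n) hA hz)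

end MinkowskiContent

section Ball

variable {d : ℕ}

lemma volume_thickening_ball_sdiff_ball {r ε : ℝ} (hr : 0 < r) (hε : 0 < ε) :
    volume (thickening ε (ball (0 : EuclideanSpace ℝ (Fin d)) r) \ ball 0 r)
      = ENNReal.ofReal ((r + ε) ^ d - r ^ d) * volume (ball (0 : EuclideanSpace ℝ (Fin d)) 1) := by
  rw [thickening_ball hε hr, add_comm ε, measure_sdiff (ball_subset_ball (by linarith))
      measurableSet_ball.nullMeasurableSet measure_ball_lt_top.ne,
    Measure.addHaar_ball_of_pos _ _ hr, Measure.addHaar_ball_of_pos _ _ (by positivity),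
    finrank_euclideanSpace_fin, ENNReal.ofReal_sub _ (by positivity),
    ENNReal.sub_mul fun _ _ => measure_ball_lt_top.ne]

theorem perimeter_ball_le {r : ℝ} (hr : 0 ≤ r) :
    perimeter (ball (0 : EuclideanSpace ℝ (Fin d)) r)
      ≤ ENNReal.ofReal (d * r ^ (d - 1)) * volume (ball (0 : EuclideanSpace ℝ (Fin d)) 1) := by
  obtain rfl | hr := hr.eq_or_lt
  · simp
  set B := ball (0 : EuclideanSpace ℝ (Fin d)) r
  set δ : ℕ → ℝ := fun n => 1 / ((n : ℝ) + 1)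
  have hδ (n) : 0 < δ n := Nat.one_div_pos_of_nat
  have hδ0 : Tendsto δ atTop (𝓝 0) := tendsto_one_div_add_atTop_nhds_zero_nat
  have closure_sdiff : volume (closure B \ B) = 0 := by
    rw [← isOpen_ball.frontier_eq]
    exact (convex_ball _ _).addHaar_frontier volume
  have slope : Tendsto (fun n => (δ n)⁻¹ * ((r + δ n) ^ d - r ^ d)) atTop (𝓝 (d * r ^ (d - 1))) :=
    (hasDerivAt_pow d r).tendsto_slope_zero.comp
      (tendsto_nhdsWithin_iff.2 ⟨hδ0, .of_forall fun n => (hδ n).ne'⟩)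
  have volume_quotient (n) : volume (thickening (δ n) B \ B) / ENNReal.ofReal (δ n)
      = ENNReal.ofReal ((δ n)⁻¹ * ((r + δ n) ^ d - r ^ d))
        * volume (ball (0 : EuclideanSpace ℝ (Fin d)) 1) := by
    rw [volume_thickening_ball_sdiff_ball hr (hδ n), div_eq_mul_inv, mul_comm, ← mul_assoc,
      ← ENNReal.ofReal_inv_of_pos (hδ n), ← ENNReal.ofReal_mul (inv_nonneg.2 (hδ n).le)]
  refine (perimeter_le_liminf_volume_thickening (A := B) measurableSet_ball closure_sdiff hδ hδ0)
    |>.trans_eq ?_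
  simp only [volume_quotient]
  exact (ENNReal.Tendsto.mul_const (ENNReal.tendsto_ofReal slope)
    (.inr measure_ball_lt_top.ne)).liminf_eq

end Ball

section Mollification

variable {V W : Type*} [NormedAddCommGroup V] [NormedSpace ℝ V] [FiniteDimensional ℝ V]
  [MeasurableSpace V] [BorelSpace V] [NormedAddCommGroup W] [NormedSpace ℝ W]
  [FiniteDimensional ℝ W] (μ : Measure V) [μ.IsAddHaarMeasure] {f : V → W}

lemma hasFDerivAt_convolution_of_lipschitzWith {φ : V → ℝ} {C : ℝ≥0} (hφ : Continuous φ)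
    (hφs : HasCompactSupport φ) (hf : LipschitzWith C f) (x : V) :
    Integrable (fun t => φ t • fderiv ℝ f (x - t)) μ ∧
      HasFDerivAt (φ ⋆[ContinuousLinearMap.lsmul ℝ ℝ, μ] f)
        (∫ t, φ t • fderiv ℝ f (x - t) ∂μ) x := by
  have hfc := hf.continuous
  have translate : Tendsto (fun t => x - t) (ae μ) (ae μ) :=
    (Measure.measurePreserving_sub_left μ x).quasiMeasurePreserving.tendsto_ae
  refine hasFDerivAt_integral_of_dominated_loc_of_lip (𝕜 := ℝ) (s := univ)
    (F := fun y t => φ t • f (y - t)) (bound := fun t => ‖φ t‖ * C) univ_mem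
    (.of_forall fun y => Continuous.aestronglyMeasurable (by fun_prop))
    (Continuous.integrable_of_hasCompactSupport (by fun_prop) hφs.smul_right)
    (hφ.aestronglyMeasurable.smul
      ((measurable_fderiv ℝ f).comp (measurable_const_sub x)).aestronglyMeasurable)
    (.of_forall fun t => ?_)
    ((hφ.integrable_of_hasCompactSupport hφs).norm.mul_const _) ?_
  · refine (LipschitzWith.of_dist_le_mul fun y y' => ?_).lipschitzOnWith
    rw [dist_smul₀, Real.coe_nnabs, abs_mul, abs_norm, NNReal.abs_eq, mul_assoc]
    gcongr
    simpa using hf.dist_le_mul (y - t) (y' - t)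
  · filter_upwards [translate.eventually hf.ae_differentiableAt] with t ht
    exact ((hasFDerivAt_comp_sub t).2 ht.hasFDerivAt).const_smul (φ t)

lemma norm_convolution_normed_le (φ : ContDiffBump (0 : V)) (hf : AEStronglyMeasurable f μ)
    {M : ℝ} (hM : 0 ≤ M) {x : V} (hfM : ∀ y ∈ ball x φ.rOut, ‖f y‖ ≤ M) :
    ‖(φ.normed μ ⋆[ContinuousLinearMap.lsmul ℝ ℝ, μ] f) x‖ ≤ M := by
  simpa using dist_convolution_le (z₀ := 0) hM φ.support_normed_eq.subset φ.nonneg_normed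
    (φ.integral_normed (μ := μ)) hf (by simpa using hfM)

lemma tendsto_setIntegral_convolution_normed {φ : ℕ → ContDiffBump (0 : V)} {K M : ℝ}
    (hφ : Tendsto (fun n => (φ n).rOut) atTop (𝓝 0)) (hφ1 : ∀ n, (φ n).rOut ≤ 1)
    (hφK : ∀ n, (φ n).rOut ≤ K * (φ n).rIn) (hf : AEStronglyMeasurable f μ)
    (hfM : ∀ x, ‖f x‖ ≤ M) (hfs : HasCompactSupport f) (F : Set V) :
    Tendsto (fun n => ∫ x in F, ((φ n).normed μ ⋆[ContinuousLinearMap.lsmul ℝ ℝ, μ] f) x ∂μ) atTop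
      (𝓝 (∫ x in F, f x ∂μ)) := by
  have hM : 0 ≤ M := (norm_nonneg _).trans (hfM 0)
  have hfi : LocallyIntegrable f μ :=
    (memLp_top_of_bound hf M (.of_forall hfM)).locallyIntegrable le_top
  have hK : IsCompact (cthickening 1 (tsupport f)) := hfs.isCompact.cthickening
  refine tendsto_integral_of_dominated_convergence
    ((cthickening 1 (tsupport f)).indicator fun _ => M) (fun n => ?_) ?_
    (fun n => .of_forall fun x => ?_) (ae_restrict_of_ae ?_)
  · exact ((φ n).hasCompactSupport_normed.continuous_convolution_left _ (φ n).continuous_normed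
      hfi).aestronglyMeasurable
  · exact (integrable_indicator_iff hK.measurableSet).2
      (integrableOn_const hK.measure_lt_top.ne) |>.restrict
  · refine norm_convolution_normed_le μ (φ n) hf (indicator_nonneg (fun _ _ => hM) x) fun y hy => ?_
    by_cases hx : x ∈ cthickening 1 (tsupport f)
    · simpa [hx] using hfM y
    have hyf : y ∉ tsupport f := fun hyf => hx <| mem_cthickening_of_dist_le x y 1 _ hyf <|
      (dist_comm x y).trans_le ((mem_ball.1 hy).le.trans (hφ1 n))
    simp [hx, image_eq_zero_of_notMem_tsupport hyf]
  · exact ContDiffBump.ae_convolution_tendsto_right_of_locallyIntegrable hφ (.of_forall hφK) hfi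

variable {d : ℕ} {v : EuclideanSpace ℝ (Fin d) → EuclideanSpace ℝ (Fin d)} {C : ℝ≥0}
  {F : Set (EuclideanSpace ℝ (Fin d))}

lemma divergence_convolution {φ : EuclideanSpace ℝ (Fin d) → ℝ} (hφ : Continuous φ)
    (hφs : HasCompactSupport φ) (hv : LipschitzWith C v) :
    divergence (φ ⋆[ContinuousLinearMap.lsmul ℝ ℝ, volume] v)
      = φ ⋆[ContinuousLinearMap.lsmul ℝ ℝ, volume] divergence v := by
  funext x
  obtain ⟨hint, hderiv⟩ := hasFDerivAt_convolution_of_lipschitzWith volume hφ hφs hv x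
  rw [divergence_eq_traceCLM, hderiv.fderiv, ← (traceCLM d).integral_comp_comm hint]
  simp [convolution, divergence_eq_traceCLM]

lemma convolution_normed_mem_testFields (φ : ContDiffBump (0 : EuclideanSpace ℝ (Fin d)))
    (hv : Continuous v) (hvs : HasCompactSupport v) (hv1 : ∀ x, ‖v x‖ ≤ 1) :
    φ.normed volume ⋆[ContinuousLinearMap.lsmul ℝ ℝ, volume] v ∈ testFields d :=
  ⟨φ.hasCompactSupport_normed.contDiff_convolution_left _ φ.contDiff_normed hv.locallyIntegrable,
    φ.hasCompactSupport_normed.convolution _ hvs, fun _ =>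
      norm_convolution_normed_le volume φ hv.aestronglyMeasurable zero_le_one fun y _ => hv1 y⟩

theorem le_perimeter_of_hasCompactSupport (hF : MeasurableSet F) (hv : LipschitzWith C v)
    (hvs : HasCompactSupport v) (hv1 : ∀ x, ‖v x‖ ≤ 1) :
    ENNReal.ofReal (∫ x in F, divergence v x) ≤ perimeter F := by
  let φ : ℕ → ContDiffBump (0 : EuclideanSpace ℝ (Fin d)) := fun n =>
    ⟨1 / ((n : ℝ) + 1) / 2, 1 / ((n : ℝ) + 1), by positivity, half_lt_self (by positivity)⟩
  have lim := tendsto_setIntegral_convolution_normed volume (φ := φ) (K := 2)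
    tendsto_one_div_add_atTop_nhds_zero_nat
    (fun n => div_le_one_of_le₀ (le_add_of_nonneg_left n.cast_nonneg) (by positivity))
    (fun n => (mul_div_cancel₀ _ two_ne_zero).ge) measurable_divergence.aestronglyMeasurable
    (norm_divergence_le hv) (hvs.mono' support_divergence_subset) F
  refine le_of_tendsto' (ENNReal.tendsto_ofReal lim) fun n => ?_
  rw [← divergence_convolution (φ n).continuous_normed (φ n).hasCompactSupport_normed hv]
  exact le_perimeter hF (convolution_normed_mem_testFields (φ n) hv.continuous hvs hv1)

end Mollification

section IntegrableFields

variable {d : ℕ} {v : EuclideanSpace ℝ (Fin d) → EuclideanSpace ℝ (Fin d)} {C : ℝ≥0}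
  {F : Set (EuclideanSpace ℝ (Fin d))}

variable (d) in
/-- The function `x ↦ max 0 (1 - dist x (ball 0 n))`, a Lipschitz cutoff at scale `n`. -/
def cutoff (n : ℕ) (x : EuclideanSpace ℝ (Fin d)) : ℝ :=
  thickenedIndicator one_pos (ball (0 : EuclideanSpace ℝ (Fin d)) n) x

lemma lipschitzWith_cutoff (n : ℕ) : LipschitzWith 1 (cutoff d n) := by
  have := lipschitzWith_coe_thickenedIndicator one_pos (ball (0 : EuclideanSpace ℝ (Fin d)) n)
  rwa [Real.toNNReal_one, inv_one] at this

lemma norm_cutoff_le_one (n : ℕ) (x : EuclideanSpace ℝ (Fin d)) : ‖cutoff d n x‖ ≤ 1 :=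
  norm_coe_thickenedIndicator_le_one one_pos _ x

lemma hasCompactSupport_cutoff (n : ℕ) : HasCompactSupport (cutoff d n) :=
  .intro (isCompact_of_isClosed_isBounded isClosed_cthickening isBounded_ball.cthickening)
    fun _ hx => NNReal.coe_eq_zero.2 <|
      thickenedIndicator_zero one_pos _ fun h => hx (thickening_subset_cthickening _ _ h)

lemma eventually_cutoff_smul_eventuallyEq (x : EuclideanSpace ℝ (Fin d)) :
    ∀ᶠ n in atTop, cutoff d n • v =ᶠ[𝓝 x] v := by
  obtain ⟨N, hN⟩ := exists_nat_gt ‖x‖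
  filter_upwards [eventually_ge_atTop N] with n hn
  have hx : x ∈ ball (0 : EuclideanSpace ℝ (Fin d)) n := by
    simpa using hN.trans_le (Nat.cast_le.2 hn)
  filter_upwards [isOpen_ball.mem_nhds hx] with y hy
  simp [cutoff, thickenedIndicator_one one_pos _ hy]

lemma ae_norm_divergence_cutoff_smul_le (hv : LipschitzWith C v) (n : ℕ) :
    ∀ᵐ x, ‖divergence (cutoff d n • v) x‖ ≤ ‖divergence v x‖ + ‖v x‖ := by
  filter_upwards [(lipschitzWith_cutoff n).ae_differentiableAt, hv.ae_differentiableAt]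
    with x hx hvx
  have norm_fderiv_le : ‖fderiv ℝ (cutoff d n) x‖ ≤ 1 :=
    norm_fderiv_le_of_lipschitz ℝ (lipschitzWith_cutoff n)
  rw [divergence_smul hx hvx]
  refine norm_add_le_of_le ?_ ?_
  · rw [norm_mul]
    exact mul_le_of_le_one_left (norm_nonneg _) (norm_cutoff_le_one n x)
  · simpa using (fderiv ℝ (cutoff d n) x).le_of_opNorm_le norm_fderiv_le (v x)

theorem le_perimeter_of_integrable (hF : MeasurableSet F) (hv : LipschitzWith C v)
    (hv1 : ∀ x, ‖v x‖ ≤ 1) (hvi : Integrable v) (hdiv : Integrable (divergence v)) :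
    ENNReal.ofReal (∫ x in F, divergence v x) ≤ perimeter F := by
  have lim : Tendsto (fun n => ∫ x in F, divergence (cutoff d n • v) x) atTop
      (𝓝 (∫ x in F, divergence v x)) :=
    tendsto_integral_of_dominated_convergence (fun x => ‖divergence v x‖ + ‖v x‖)
      (fun n => measurable_divergence.aestronglyMeasurable) (hdiv.norm.add hvi.norm).restrict
      (fun n => ae_restrict_of_ae (ae_norm_divergence_cutoff_smul_le hv n))
      (.of_forall fun x => tendsto_const_nhds.congr' <|
        (eventually_cutoff_smul_eventuallyEq x).mono fun n hn => (divergence_congr hn).symm)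
  refine le_of_tendsto' (ENNReal.tendsto_ofReal lim) fun n => ?_
  refine le_perimeter_of_hasCompactSupport hF (lipschitzWith_smul_of_norm_le (M := 1) (N := 1)
    (lipschitzWith_cutoff n) (norm_cutoff_le_one n) hv hv1) (hasCompactSupport_cutoff n).smul_right
    fun x => ?_
  simpa [norm_smul] using mul_le_one₀ (norm_cutoff_le_one n x) (norm_nonneg _) (hv1 x)

theorem abs_setIntegral_divergence_le (hF : FinitePerimeter F) (hv : LipschitzWith C v)
    (hv1 : ∀ x, ‖v x‖ ≤ 1) (hvi : Integrable v) (hdiv : Integrable (divergence v)) :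
    |∫ x in F, divergence v x| ≤ (perimeter F).toReal := by
  have div_neg : divergence (-v) = -divergence v := funext (divergence_neg v)
  have pos := le_perimeter_of_integrable hF.1 hv hv1 hvi hdiv
  have neg := le_perimeter_of_integrable hF.1 hv.neg (by simpa using hv1) hvi.neg
    (div_neg ▸ hdiv.neg)
  rw [div_neg] at neg
  simp only [Pi.neg_apply, integral_neg] at neg
  exact abs_le'.2 ⟨(ENNReal.ofReal_le_iff_le_toReal hF.2.ne).1 pos,
    (ENNReal.ofReal_le_iff_le_toReal hF.2.ne).1 neg⟩

end IntegrableFields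

section SelfCheeger

variable {d : ℕ} {h : EuclideanSpace ℝ (Fin d) → ℝ} {E M F : Set (EuclideanSpace ℝ (Fin d))}
  {S : ℝ → Set (EuclideanSpace ℝ (Fin d))} {x : EuclideanSpace ℝ (Fin d)} {c l : ℝ}

/-- `E` is a Cheeger set of itself for the density `h`, with Cheeger constant `c`: among the subsets
`F` of `E`, the quotient `Per F / ∫_F h` is at least `c`, and it equals `c` at `F = E`. -/
structure IsSelfCheeger (h : EuclideanSpace ℝ (Fin d) → ℝ) (E : Set (EuclideanSpace ℝ (Fin d)))
    (c : ℝ) : Prop where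
  pos : 0 < c
  finitePerimeter : FinitePerimeter E
  le : ∀ F, F ⊆ E → FinitePerimeter F → c * ∫ x in F, h x ≤ (perimeter F).toReal
  eq : (perimeter E).toReal = c * ∫ x in E, h x

lemma setIntegral_nonneg_of_isDensity (hh : IsDensity h) : 0 ≤ ∫ x in F, h x :=
  integral_nonneg_of_ae (ae_restrict_of_ae (hh.2.mono fun _ hx => hx.le))

lemma setIntegral_mono_of_isDensity (hh : IsDensity h) (hFE : F ⊆ E) :
    ∫ x in F, h x ≤ ∫ x in E, h x :=
  setIntegral_mono_set hh.1.integrableOn (ae_restrict_of_ae (hh.2.mono fun _ hx => hx.le))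
    hFE.eventuallyLE

lemma ae_notMem_of_setIntegral_nonpos (hh : IsDensity h) (hF : MeasurableSet F)
    (hF0 : ∫ x in F, h x ≤ 0) : ∀ᵐ x, x ∉ F := by
  have ae_zero := hF0.antisymm (setIntegral_nonneg_of_isDensity hh)
  rw [integral_eq_zero_iff_of_nonneg_ae (ae_restrict_of_ae (hh.2.mono fun _ hx => hx.le))
    hh.1.integrableOn] at ae_zero
  filter_upwards [(ae_restrict_iff' hF).1 ae_zero, hh.2] with x hx hpos hxF
  exact hpos.ne' (hx hxF)

lemma energy_const_mul (l : ℝ) (h : EuclideanSpace ℝ (Fin d) → ℝ)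
    (F : Set (EuclideanSpace ℝ (Fin d))) :
    energy (fun x => l * h x) F = (perimeter F).toReal - l * ∫ x in F, h x := by
  rw [energy, integral_const_mul]

@[simp] lemma energy_empty (g : EuclideanSpace ℝ (Fin d) → ℝ) : energy g ∅ = 0 := by
  simp [energy]

theorem IsSelfCheeger.isMinimizerFamily (hE : IsSelfCheeger h E c) (hh : IsDensity h) :
    IsMinimizerFamily h E fun l => if l < c then ∅ else E where
  minimizes l _ := by
    split_ifs with hlc
    · refine ⟨empty_subset E, finitePerimeter_empty, fun F hFE hF => ?_⟩
      rw [energy_empty, energy_const_mul, sub_nonneg]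
      exact (mul_le_mul_of_nonneg_right hlc.le (setIntegral_nonneg_of_isDensity hh)).trans
        (hE.le F hFE hF)
    · refine ⟨subset_rfl, hE.finitePerimeter, fun F hFE hF => ?_⟩
      rw [energy_const_mul, energy_const_mul, hE.eq]
      have gap := mul_le_mul_of_nonneg_left (setIntegral_mono_of_isDensity hh hFE)
        (sub_nonneg.2 (not_lt.1 hlc))
      linarith [hE.le F hFE hF]
  nested l m _ hlm := by
    split_ifs with hl hm hm
    · exact subset_rfl
    · exact empty_subset _
    · exact absurd (hlm.trans hm) hl
    · exact subset_rfl

lemma IsSelfCheeger.ae_notMem_of_lt (hE : IsSelfCheeger h E c) (hh : IsDensity h) (hlc : l < c)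
    (hM : IsMinimizerIn (fun x => l * h x) E M) : ∀ᵐ x, x ∉ M := by
  refine ae_notMem_of_setIntegral_nonpos hh hM.finitePerimeter.1 ?_
  have energy_le := hM.le ∅ (empty_subset E) finitePerimeter_empty
  rw [energy_empty, energy_const_mul] at energy_le
  refine le_of_mul_le_mul_left ?_ (sub_pos.2 hlc)
  linarith [hE.le M hM.subset hM.finitePerimeter]

lemma IsSelfCheeger.ae_notMem_sdiff_of_gt (hE : IsSelfCheeger h E c) (hh : IsDensity h)
    (hcl : c < l) (hM : IsMinimizerIn (fun x => l * h x) E M) : ∀ᵐ x, x ∉ E \ M := by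
  refine ae_notMem_of_setIntegral_nonpos hh (hE.finitePerimeter.1.diff hM.finitePerimeter.1) ?_
  have energy_le := hM.le E subset_rfl hE.finitePerimeter
  rw [energy_const_mul, energy_const_mul, hE.eq] at energy_le
  rw [setIntegral_sdiff hM.finitePerimeter.1 hh.1.integrableOn hM.subset, sub_nonpos]
  refine le_of_mul_le_mul_left ?_ (sub_pos.2 hcl)
  linarith [hE.le M hM.subset hM.finitePerimeter]

lemma IsSelfCheeger.ae_forall_notMem (hE : IsSelfCheeger h E c) (hh : IsDensity h)
    (hS : IsMinimizerFamily h E S) : ∀ᵐ x, ∀ l, 0 < l → l < c → x ∉ S l := by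
  have ae_rat : ∀ᵐ x, ∀ q : ℚ, 0 < (q : ℝ) → (q : ℝ) < c → x ∉ S q :=
    ae_all_iff.2 fun q => eventually_imp_distrib_left.2 fun hq =>
      eventually_imp_distrib_left.2 fun hqc => hE.ae_notMem_of_lt hh hqc (hS.minimizes q hq)
  filter_upwards [ae_rat] with x hx l hl hlc hxl
  obtain ⟨q, hlq, hqc⟩ := exists_rat_btwn hlc
  exact hx q (hl.trans hlq) hqc (hS.nested l q hl hlq hxl)

lemma IsSelfCheeger.ae_forall_mem (hE : IsSelfCheeger h E c) (hh : IsDensity h)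
    (hS : IsMinimizerFamily h E S) : ∀ᵐ x ∂volume.restrict E, ∀ l, c < l → x ∈ S l := by
  have ae_rat : ∀ᵐ x, ∀ q : ℚ, c < (q : ℝ) → x ∉ E \ S q :=
    ae_all_iff.2 fun q => eventually_imp_distrib_left.2 fun hcq =>
      hE.ae_notMem_sdiff_of_gt hh hcq (hS.minimizes q (hE.pos.trans hcq))
  filter_upwards [ae_restrict_of_ae ae_rat, ae_restrict_mem hE.finitePerimeter.1]
    with x hx hxE l hcl
  obtain ⟨q, hcq, hql⟩ := exists_rat_btwn hcl
  exact hS.nested q l (hE.pos.trans hcq) hql (by simpa [hxE] using hx q hcq)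

lemma levelCurvature_eq_mul (hx : 0 < h x) (hc : 0 < c) (hlt : ∀ l, 0 < l → l < c → x ∉ S l)
    (hgt : ∀ l, c < l → x ∈ S l) : levelCurvature h S x = c * h x := by
  have isGLB : IsGLB {t | ∃ l, 0 < l ∧ x ∈ S l ∧ t = l * h x} (c * h x) := by
    refine ⟨?_, fun b hb => ?_⟩
    · rintro _ ⟨l, hl, hxl, rfl⟩
      gcongr
      exact not_lt.1 fun hlc => hlt l hl hlc hxl
    · rw [← div_le_iff₀ hx]
      refine le_of_forall_gt_imp_ge_of_dense fun l hcl => ?_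
      exact (div_le_iff₀ hx).2 (hb ⟨l, hc.trans hcl, hgt l hcl, rfl⟩)
  exact isGLB.csInf_eq ⟨_, c + 1, by positivity, hgt _ (lt_add_one c), rfl⟩

theorem IsSelfCheeger.levelCurvature_ae_eq (hE : IsSelfCheeger h E c) (hh : IsDensity h)
    (hS : IsMinimizerFamily h E S) :
    ∀ᵐ x ∂volume.restrict E, levelCurvature h S x = c * h x := by
  filter_upwards [ae_restrict_of_ae (hE.ae_forall_notMem hh hS), hE.ae_forall_mem hh hS,
    ae_restrict_of_ae hh.2] with x hlt hgt hpos
  exact levelCurvature_eq_mul hpos hE.pos hlt hgt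

end SelfCheeger

section Calibration

variable {d : ℕ} {h κ : EuclideanSpace ℝ (Fin d) → ℝ} {E : Set (EuclideanSpace ℝ (Fin d))} {c : ℝ}

/-- `κ` calibrates `E`: its integral over any set is bounded by the perimeter of this set, with
equality on `E`. This is the case if `κ` is the divergence of a field of norm at most one which is
the outer normal on the boundary of `E`. -/
structure IsCalibratedBy (E : Set (EuclideanSpace ℝ (Fin d))) (κ : EuclideanSpace ℝ (Fin d) → ℝ) :
    Prop where
  integrable : Integrable κ
  finitePerimeter : FinitePerimeter E
  abs_le : ∀ F, FinitePerimeter F → |∫ x in F, κ x| ≤ (perimeter F).toReal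
  eq : ∫ x in E, κ x = (perimeter E).toReal

namespace IsCalibratedBy

lemma integral_eq_zero (hκ : IsCalibratedBy E κ) : ∫ x, κ x = 0 := by
  simpa using hκ.abs_le univ finitePerimeter_univ

lemma compl (hκ : IsCalibratedBy E κ) : IsCalibratedBy Eᶜ (-κ) where
  integrable := hκ.integrable.neg
  finitePerimeter := finitePerimeter_compl hκ.finitePerimeter
  abs_le F hF := by simpa [integral_neg] using hκ.abs_le F hF
  eq := by
    have split := integral_add_compl hκ.finitePerimeter.1 hκ.integrable
    rw [hκ.integral_eq_zero, hκ.eq, add_eq_zero_iff_eq_neg] at split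
    simp [integral_neg, perimeter_compl hκ.finitePerimeter.1, split]

lemma isVariationalCurvature (hκ : IsCalibratedBy E κ) : IsVariationalCurvature E κ := by
  refine ⟨hκ.integrable, subset_univ E, hκ.finitePerimeter, fun F _ hF => ?_⟩
  rw [energy, energy, hκ.eq, sub_self, sub_nonneg]
  exact (le_abs_self _).trans (hκ.abs_le F hF)

lemma integral_norm (hκ : IsCalibratedBy E κ) (hin : ∀ᵐ x ∂volume.restrict E, 0 ≤ κ x)
    (hout : ∀ᵐ x ∂volume.restrict Eᶜ, κ x ≤ 0) : ∫ x, ‖κ x‖ = 2 * (perimeter E).toReal := by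
  have norm_in : ∫ x in E, ‖κ x‖ = ∫ x in E, κ x :=
    integral_congr_ae (hin.mono fun x hx => Real.norm_of_nonneg hx)
  have norm_out : ∫ x in Eᶜ, ‖κ x‖ = ∫ x in Eᶜ, (-κ) x :=
    integral_congr_ae (hout.mono fun x hx => Real.norm_of_nonpos hx)
  rw [← integral_add_compl hκ.finitePerimeter.1 hκ.integrable.norm, norm_in, norm_out, hκ.eq,
    hκ.compl.eq, perimeter_compl hκ.finitePerimeter.1, two_mul]

lemma isSelfCheeger (hκ : IsCalibratedBy E κ) (hc : 0 < c)
    (hκh : ∀ᵐ x ∂volume.restrict E, κ x = c * h x) : IsSelfCheeger h E c := by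
  have mul_integral {F : Set (EuclideanSpace ℝ (Fin d))} (hF : F ⊆ E) :
      c * ∫ x in F, h x = ∫ x in F, κ x := by
    rw [← integral_const_mul]
    exact (integral_congr_ae (ae_restrict_of_ae_restrict_of_subset hF hκh)).symm
  refine ⟨hc, hκ.finitePerimeter, fun F hFE hF => ?_, ?_⟩
  · exact (mul_integral hFE).trans_le ((le_abs_self _).trans (hκ.abs_le F hF))
  · rw [mul_integral subset_rfl, hκ.eq]

theorem isOptimalCurvature (hκ : IsCalibratedBy E κ) (hh : IsDensity h) {c' : ℝ} (hc : 0 < c)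
    (hc' : 0 < c') (hin : ∀ᵐ x ∂volume.restrict E, κ x = c * h x)
    (hout : ∀ᵐ x ∂volume.restrict Eᶜ, κ x = -(c' * h x)) : IsOptimalCurvature h E κ := by
  have cheeger_in : IsSelfCheeger h E c := hκ.isSelfCheeger hc hin
  have cheeger_out : IsSelfCheeger h Eᶜ c' :=
    hκ.compl.isSelfCheeger hc' (hout.mono fun x hx => by simp [hx])
  refine ⟨⟨_, cheeger_in.isMinimizerFamily hh, ?_⟩, ⟨_, cheeger_out.isMinimizerFamily hh, ?_⟩⟩
  · filter_upwards [cheeger_in.levelCurvature_ae_eq hh (cheeger_in.isMinimizerFamily hh), hin]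
      with x hlevel hx
    rw [hx, hlevel]
  · filter_upwards [cheeger_out.levelCurvature_ae_eq hh (cheeger_out.isMinimizerFamily hh), hout]
      with x hlevel hx
    rw [hx, hlevel]

end IsCalibratedBy

theorem two_mul_perimeter_le_integral_norm (hκ : IsVariationalCurvature E κ) :
    2 * (perimeter E).toReal ≤ ∫ x, ‖κ x‖ := by
  have hE := hκ.2.finitePerimeter.1
  have energy_le_empty := hκ.2.le ∅ (subset_univ _) finitePerimeter_empty
  have energy_le_univ := hκ.2.le univ subset_rfl finitePerimeter_univ
  rw [energy_empty, energy] at energy_le_empty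
  simp only [energy, perimeter_univ, ENNReal.toReal_zero, setIntegral_univ, zero_sub,
    ← integral_add_compl hE hκ.1] at energy_le_univ
  calc 2 * (perimeter E).toReal ≤ |∫ x in E, κ x| + |∫ x in Eᶜ, κ x| := by
        linarith [le_abs_self (∫ x in E, κ x), neg_le_abs (∫ x in Eᶜ, κ x)]
    _ ≤ (∫ x in E, ‖κ x‖) + ∫ x in Eᶜ, ‖κ x‖ :=
        add_le_add (norm_integral_le_integral_norm κ) (norm_integral_le_integral_norm κ)
    _ = ∫ x, ‖κ x‖ := integral_add_compl hE hκ.1.norm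

namespace IsCalibratedBy

theorem exists_isOptimalCurvature (hκ : IsCalibratedBy E κ) (hc : 0 < c)
    (hin : ∀ᵐ x ∂volume.restrict E, κ x = c) (hout : ∀ᵐ x ∂volume.restrict Eᶜ, κ x < 0) :
    ∃ h κ : EuclideanSpace ℝ (Fin d) → ℝ, IsDensity h ∧ (∀ᵐ x ∂volume.restrict E, h x = 1) ∧
      IsOptimalCurvature h E κ ∧ IsVariationalCurvature E κ ∧
      ∀ κ', IsVariationalCurvature E κ' → ∫ x, ‖κ x‖ ≤ ∫ x, ‖κ' x‖ := by
  set h : EuclideanSpace ℝ (Fin d) → ℝ := fun x => max (c⁻¹ * κ x) (-κ x)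
  have h_in : ∀ᵐ x ∂volume.restrict E, h x = 1 := hin.mono fun x hx => by
    simp only [h, hx, inv_mul_cancel₀ hc.ne']
    exact max_eq_left (by linarith)
  have h_out : ∀ᵐ x ∂volume.restrict Eᶜ, h x = -κ x := hout.mono fun x hx => by
    exact max_eq_right ((mul_nonpos_of_nonneg_of_nonpos (by positivity) hx.le).trans (by linarith))
  have density : IsDensity h := by
    refine ⟨(hκ.integrable.const_mul c⁻¹).sup hκ.integrable.neg, ?_⟩
    refine ae_of_ae_restrict_of_ae_restrict_compl E (h_in.mono fun x hx => hx ▸ one_pos) ?_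
    filter_upwards [h_out, hout] with x hx hneg
    rw [hx]
    exact neg_pos.2 hneg
  refine ⟨h, κ, density, h_in, hκ.isOptimalCurvature density hc one_pos ?_ ?_,
    hκ.isVariationalCurvature, fun κ' hκ' => ?_⟩
  · filter_upwards [hin, h_in] with x hx hhx
    rw [hx, hhx, mul_one]
  · filter_upwards [h_out] with x hx
    rw [hx, one_mul, neg_neg]
  · rw [hκ.integral_norm (hin.mono fun x hx => hx ▸ hc.le) (hout.mono fun x hx => hx.le)]
    exact two_mul_perimeter_le_integral_norm hκ'

theorem ae_eq_of_isOptimalCurvature (hκ : IsCalibratedBy E κ) (hc : 0 < c)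
    (hin : ∀ᵐ x ∂volume.restrict E, κ x = c) (hh : IsDensity h)
    (hh1 : ∀ᵐ x ∂volume.restrict E, h x = 1) {κ' : EuclideanSpace ℝ (Fin d) → ℝ}
    (hκ' : IsOptimalCurvature h E κ') : ∀ᵐ x ∂volume.restrict E, κ' x = c := by
  have cheeger : IsSelfCheeger h E c := by
    refine hκ.isSelfCheeger hc ?_
    filter_upwards [hin, hh1] with x hx hhx
    rw [hx, hhx, mul_one]
  obtain ⟨S, hS, hlevel⟩ := hκ'.inside
  filter_upwards [hlevel, cheeger.levelCurvature_ae_eq hh hS, hh1] with x hx hlx hhx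
  rw [hx, hlx, hhx, mul_one]

end IsCalibratedBy

end Calibration

section RadialField

section Lipschitz

variable {V : Type*} [NormedAddCommGroup V] {R : ℝ}

lemma abs_inv_max_norm_sub_inv_max_norm_le (hR : 0 < R) (x y : V) :
    |(max R ‖x‖)⁻¹ - (max R ‖y‖)⁻¹| ≤ R⁻¹ * (max R ‖y‖)⁻¹ * ‖x - y‖ := by
  have max_pos (x : V) : 0 < max R ‖x‖ := lt_max_of_lt_left hR
  rw [inv_sub_inv (max_pos x).ne' (max_pos y).ne', abs_div, abs_mul, abs_of_pos (max_pos x),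
    abs_of_pos (max_pos y), div_eq_inv_mul, mul_inv]
  gcongr
  · exact le_max_left _ _
  · rw [abs_sub_comm]
    exact (abs_max_sub_max_le_max _ _ _ _).trans (by simpa using abs_norm_sub_norm_le x y)

lemma exists_lipschitzWith_max_norm_pow_inv_smul [NormedSpace ℝ V] (hR : 0 < R) (k : ℕ) :
    ∃ C, LipschitzWith C fun x : V => (max R ‖x‖ ^ k)⁻¹ • x := by
  induction k with
  | zero => exact ⟨1, by simpa using! LipschitzWith.id (α := V)⟩
  | succ k ih =>
    obtain ⟨C, hC⟩ := ih
    have max_pos (x : V) : 0 < max R ‖x‖ := lt_max_of_lt_left hR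
    refine ⟨_, LipschitzWith.of_dist_le' (K := R⁻¹ * C + R⁻¹ * (R ^ k)⁻¹) fun x y => ?_⟩
    rw [dist_eq_norm, dist_eq_norm]
    calc ‖(max R ‖x‖ ^ (k + 1))⁻¹ • x - (max R ‖y‖ ^ (k + 1))⁻¹ • y‖
        = ‖(max R ‖x‖)⁻¹ • ((max R ‖x‖ ^ k)⁻¹ • x - (max R ‖y‖ ^ k)⁻¹ • y)
            + ((max R ‖x‖)⁻¹ - (max R ‖y‖)⁻¹) • (max R ‖y‖ ^ k)⁻¹ • y‖ := by
          congr 1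
          simp only [pow_succ, mul_inv_rev, mul_smul]
          module
      _ ≤ (max R ‖x‖)⁻¹ * ‖(max R ‖x‖ ^ k)⁻¹ • x - (max R ‖y‖ ^ k)⁻¹ • y‖
            + |(max R ‖x‖)⁻¹ - (max R ‖y‖)⁻¹| * ((max R ‖y‖ ^ k)⁻¹ * ‖y‖) := by
          refine (norm_add_le _ _).trans_eq ?_
          simp only [norm_smul, norm_inv, norm_pow, Real.norm_eq_abs, abs_of_pos (max_pos _)]
      _ ≤ R⁻¹ * (C * ‖x - y‖)
            + R⁻¹ * (max R ‖y‖)⁻¹ * ‖x - y‖ * ((R ^ k)⁻¹ * ‖y‖) := by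
          gcongr
          · exact le_max_left _ _
          · exact hC.norm_sub_le x y
          · exact abs_inv_max_norm_sub_inv_max_norm_le hR x y
          · exact le_max_left _ _
      _ = R⁻¹ * C * ‖x - y‖
            + R⁻¹ * (R ^ k)⁻¹ * ‖x - y‖ * ((max R ‖y‖)⁻¹ * ‖y‖) := by ring
      _ ≤ R⁻¹ * C * ‖x - y‖ + R⁻¹ * (R ^ k)⁻¹ * ‖x - y‖ * 1 := by
          gcongr
          exact inv_mul_le_one_of_le₀ (le_max_right _ _) (max_pos y).le
      _ = (R⁻¹ * C + R⁻¹ * (R ^ k)⁻¹) * ‖x - y‖ := by ring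

end Lipschitz

lemma divergence_radial {d : ℕ} {f : ℝ → ℝ} {f' : ℝ} {x : EuclideanSpace ℝ (Fin d)} (hx : x ≠ 0)
    (hf : HasDerivAt f f' ‖x‖) :
    divergence (fun y => f ‖y‖ • y) x = d * f ‖x‖ + f' * ‖x‖ := by
  have norm_differentiableAt : DifferentiableAt ℝ (fun y => ‖y‖) x := differentiableAt_id.norm ℝ hx
  have hasFDerivAt_norm : HasFDerivAt (fun y => f ‖y‖) (f' • fderiv ℝ (fun y => ‖y‖) x) x :=
    hf.comp_hasFDerivAt x norm_differentiableAt.hasFDerivAt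
  have divergence_id : divergence id x = d := by
    rw [divergence_eq_traceCLM, fderiv_id, traceCLM_id]
  calc divergence (fun y => f ‖y‖ • y) x
      = f ‖x‖ * divergence id x + fderiv ℝ (fun y => f ‖y‖) x x :=
        divergence_smul hasFDerivAt_norm.differentiableAt differentiableAt_id
    _ = d * f ‖x‖ + f' * ‖x‖ := by
        rw [divergence_id, hasFDerivAt_norm.fderiv, smul_apply, smul_eq_mul,
          norm_differentiableAt.fderiv_norm_self, mul_comm]

lemma divergence_radial_of_eventuallyEq {d k : ℕ} {f : ℝ → ℝ} {a b : ℝ}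
    {x : EuclideanSpace ℝ (Fin d)} (hx : x ≠ 0) (hf : f =ᶠ[𝓝 ‖x‖] fun r => a + b * (r ^ k)⁻¹) :
    divergence (fun y => f ‖y‖ • y) x = d * a + (d - k) * b * (‖x‖ ^ k)⁻¹ := by
  have hx' : ‖x‖ ≠ 0 := norm_ne_zero_iff.2 hx
  have hasDerivAt := ((((hasDerivAt_pow k ‖x‖).inv (pow_ne_zero k hx')).const_mul b).const_add
    a).congr_of_eventuallyEq hf
  rw [divergence_radial hx hasDerivAt, hf.eq_of_nhds]
  rcases k with _ | k
  · simp only [pow_zero, Nat.cast_zero]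
    ring
  · push_cast
    field_simp
    ring

lemma integrable_of_norm_le_of_norm_le_div_pow {V W : Type*} [NormedAddCommGroup V]
    [NormedSpace ℝ V] [FiniteDimensional ℝ V] [MeasurableSpace V] [BorelSpace V]
    [NormedAddCommGroup W] {μ : Measure V} [μ.IsAddHaarMeasure] {f : V → W} {k : ℕ} {C M R : ℝ}
    (hk : Module.finrank ℝ V < k) (hR : 0 < R) (hf : AEStronglyMeasurable f μ)
    (hM : ∀ᵐ x ∂μ, ‖f x‖ ≤ M) (hC : ∀ᵐ x ∂μ, R < ‖x‖ → ‖f x‖ ≤ C * (‖x‖ ^ k)⁻¹) :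
    Integrable f μ := by
  have integrable_decay : Integrable (fun x : V => (1 + ‖x‖) ^ (-(k : ℝ))) μ :=
    integrable_one_add_norm (by exact_mod_cast hk)
  refine (integrable_decay.const_mul (|M| * (1 + R) ^ k + |C| * (R⁻¹ + 1) ^ k)).mono' hf ?_
  filter_upwards [hM, hC] with x hxM hxC
  rw [Real.rpow_neg (by positivity), Real.rpow_natCast, add_mul]
  rcases le_or_gt ‖x‖ R with hxR | hxR
  · refine le_add_of_le_of_nonneg ?_ (by positivity)
    calc ‖f x‖ ≤ |M| * 1 := by linarith [le_abs_self M]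
      _ ≤ |M| * ((1 + R) ^ k * ((1 + ‖x‖) ^ k)⁻¹) := by
        gcongr
        rw [← div_eq_mul_inv, one_le_div (by positivity)]
        gcongr
      _ = |M| * (1 + R) ^ k * ((1 + ‖x‖) ^ k)⁻¹ := by ring
  · refine le_add_of_nonneg_of_le (by positivity) ?_
    have hx : 0 < ‖x‖ := hR.trans hxR
    have one_add_norm_le : 1 + ‖x‖ ≤ (R⁻¹ + 1) * ‖x‖ := by
      have : 1 ≤ R⁻¹ * ‖x‖ := by rw [← div_eq_inv_mul, one_le_div hR]; exact hxR.le
      linarith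
    calc ‖f x‖ ≤ |C| * (‖x‖ ^ k)⁻¹ := (hxC hxR).trans (by gcongr; exact le_abs_self C)
      _ ≤ |C| * ((R⁻¹ + 1) ^ k * ((1 + ‖x‖) ^ k)⁻¹) := by
        gcongr
        rw [← div_eq_mul_inv, inv_le_iff_one_le_mul₀ (by positivity), div_mul_eq_mul_div,
          one_le_div (by positivity), ← mul_pow]
        gcongr
      _ = |C| * (R⁻¹ + 1) ^ k * ((1 + ‖x‖) ^ k)⁻¹ := by ring

end RadialField

section ShellProfile

variable {d : ℕ} {r₁ r₂ r : ℝ}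

/-- The slope `α` of the radial component `r ↦ α r - K r ^ (1 - d)` of the calibrating field of the
shell `{r₁ ≤ r < r₂}` in `ℝ^d`. Its multiple `d α` is the divergence of the field on the shell, and
the quotient of the perimeter and the volume of the shell. -/
def shellSlope (d : ℕ) (r₁ r₂ : ℝ) : ℝ :=
  (r₁ ^ (d - 1) + r₂ ^ (d - 1)) / (r₂ ^ d - r₁ ^ d)

/-- The coefficient `K` of the divergence-free part of the radial component
`r ↦ α r - K r ^ (1 - d)` of the calibrating field of a shell, determined by the value `-1` at
`r = r₁`. -/
def shellFlux (d : ℕ) (r₁ r₂ : ℝ) : ℝ :=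
  r₁ ^ (d - 1) * (1 + shellSlope d r₁ r₂ * r₁)

/-- The calibrating field of a shell is `x ↦ shellProfile d r₁ r₂ ‖x‖ • x`. The maxima freeze the
powers of `r` at the boundary radii, such that the field is `-x / r₁` inside of the shell,
`(α - K r ^ (-d)) x` on the shell, and `r₂ ^ (d + 1) r ^ (-(d + 2)) x` outside. -/
def shellProfile (d : ℕ) (r₁ r₂ r : ℝ) : ℝ :=
  r₂ ^ (d + 1) * (max r₂ r ^ (d + 2))⁻¹
    + shellFlux d r₁ r₂ * ((max r₂ r ^ d)⁻¹ - (max r₁ r ^ d)⁻¹)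

lemma shellSlope_pos (hd : d ≠ 0) (hr₁ : 0 ≤ r₁) (hr : r₁ < r₂) : 0 < shellSlope d r₁ r₂ := by
  have hr₂ : 0 < r₂ := hr₁.trans_lt hr
  have pow_lt : r₁ ^ d < r₂ ^ d := pow_lt_pow_left₀ hr hr₁ hd
  exact div_pos (by positivity) (sub_pos.2 pow_lt)

lemma shellFlux_nonneg (hd : d ≠ 0) (hr₁ : 0 ≤ r₁) (hr : r₁ < r₂) : 0 ≤ shellFlux d r₁ r₂ := by
  have slope_pos := shellSlope_pos hd hr₁ hr
  unfold shellFlux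
  positivity

lemma shellFlux_mul_inv_left_pow (hd : d ≠ 0) (hr₁ : 0 < r₁) :
    shellFlux d r₁ r₂ * (r₁ ^ d)⁻¹ = shellSlope d r₁ r₂ + r₁⁻¹ := by
  rw [shellFlux, ← pow_sub_one_mul hd r₁]
  field_simp
  ring

lemma shellFlux_mul_inv_right_pow (hd : d ≠ 0) (hr₁ : 0 ≤ r₁) (hr : r₁ < r₂) :
    shellFlux d r₁ r₂ * (r₂ ^ d)⁻¹ = shellSlope d r₁ r₂ - r₂⁻¹ := by
  have hr₂ : 0 < r₂ := hr₁.trans_lt hr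
  have pow_sub_ne : r₂ ^ d - r₁ ^ d ≠ 0 := (sub_pos.2 (pow_lt_pow_left₀ hr hr₁ hd)).ne'
  rw [shellFlux, shellSlope]
  field_simp
  rw [← pow_sub_one_mul hd r₁, ← pow_sub_one_mul hd r₂]
  ring

lemma shellProfile_of_le_left (hd : d ≠ 0) (hr₁ : 0 < r₁) (hr : r₁ < r₂) (h : r ≤ r₁) :
    shellProfile d r₁ r₂ r = -r₁⁻¹ := by
  have hr₂ : 0 < r₂ := hr₁.trans hr
  rw [shellProfile, max_eq_left (h.trans hr.le), max_eq_left h, mul_sub,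
    shellFlux_mul_inv_left_pow hd hr₁, shellFlux_mul_inv_right_pow hd hr₁.le hr]
  field_simp
  ring

lemma shellProfile_of_mem_Icc (hd : d ≠ 0) (hr₁ : 0 ≤ r₁) (hr : r₁ < r₂) (h : r ∈ Icc r₁ r₂) :
    shellProfile d r₁ r₂ r = shellSlope d r₁ r₂ + -shellFlux d r₁ r₂ * (r ^ d)⁻¹ := by
  have hr₂ : 0 < r₂ := hr₁.trans_lt hr
  rw [shellProfile, max_eq_left h.2, max_eq_right h.1, mul_sub,
    shellFlux_mul_inv_right_pow hd hr₁ hr]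
  field_simp
  ring

lemma shellProfile_of_right_le (hr : r₁ < r₂) (h : r₂ ≤ r) :
    shellProfile d r₁ r₂ r = r₂ ^ (d + 1) * (r ^ (d + 2))⁻¹ := by
  rw [shellProfile, max_eq_right h, max_eq_right (hr.le.trans h), sub_self, mul_zero, add_zero]

lemma abs_shellProfile_mul_le_one_of_mem_Icc (hd : d ≠ 0) (hr₁ : 0 ≤ r₁) (hr : r₁ < r₂)
    (hr0 : 0 < r) (h : r ∈ Icc r₁ r₂) : |shellProfile d r₁ r₂ r * r| ≤ 1 := by
  have hr₂ : 0 < r₂ := hr₁.trans_lt hr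
  have slope_pos := shellSlope_pos hd hr₁ hr
  have flux_nonneg := shellFlux_nonneg hd hr₁ hr
  have profile_eq := shellProfile_of_mem_Icc hd hr₁ hr h
  have profile_le : shellProfile d r₁ r₂ r ≤ r₂⁻¹ := by
    have : shellFlux d r₁ r₂ * (r₂ ^ d)⁻¹ ≤ shellFlux d r₁ r₂ * (r ^ d)⁻¹ := by
      gcongr
      exact h.2
    linarith [shellFlux_mul_inv_right_pow hd hr₁ hr]
  have flux_le : shellFlux d r₁ r₂ ≤ r ^ (d - 1) * (1 + shellSlope d r₁ r₂ * r) := by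
    unfold shellFlux
    gcongr <;> exact h.1
  have flux_mul_le : shellFlux d r₁ r₂ * (r ^ d)⁻¹ * r ≤ 1 + shellSlope d r₁ r₂ * r := by
    calc shellFlux d r₁ r₂ * (r ^ d)⁻¹ * r = shellFlux d r₁ r₂ / r ^ (d - 1) := by
          rw [← pow_sub_one_mul hd r]
          field_simp
      _ ≤ 1 + shellSlope d r₁ r₂ * r := (div_le_iff₀' (by positivity)).2 flux_le
  refine abs_le.2 ⟨by linear_combination flux_mul_le - r * profile_eq, ?_⟩
  calc shellProfile d r₁ r₂ r * r ≤ r₂⁻¹ * r₂ := by gcongr; exact h.2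
    _ = 1 := inv_mul_cancel₀ hr₂.ne'

lemma abs_shellProfile_mul_le_one (hd : d ≠ 0) (hr₁ : 0 ≤ r₁) (hr : r₁ < r₂) (hr0 : 0 ≤ r) :
    |shellProfile d r₁ r₂ r * r| ≤ 1 := by
  obtain rfl | hr0 := hr0.eq_or_lt
  · simp
  rcases lt_or_ge r r₁ with h | h
  · have hr₁ : 0 < r₁ := hr0.trans h
    rw [shellProfile_of_le_left hd hr₁ hr h.le, neg_mul, abs_neg, abs_of_pos (by positivity)]
    exact inv_mul_le_one_of_le₀ h.le hr₁.le
  rcases le_total r r₂ with h' | h'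
  · exact abs_shellProfile_mul_le_one_of_mem_Icc hd hr₁ hr hr0 ⟨h, h'⟩
  · have hr₂ : 0 < r₂ := hr₁.trans_lt hr
    rw [shellProfile_of_right_le hr h', abs_of_nonneg (by positivity)]
    calc r₂ ^ (d + 1) * (r ^ (d + 2))⁻¹ * r = (r₂ / r) ^ (d + 1) := by
          rw [div_pow]
          field_simp
          ring
      _ ≤ 1 := pow_le_one₀ (by positivity) ((div_le_one hr0).2 h')

end ShellProfile

section Shell

variable {d : ℕ} {r₁ r₂ : ℝ} {x : EuclideanSpace ℝ (Fin d)}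

/-- The spherical shell `B(0, r₂) \ B(0, r₁)` in `ℝ^d`. -/
def shell (d : ℕ) (r₁ r₂ : ℝ) : Set (EuclideanSpace ℝ (Fin d)) :=
  ball 0 r₂ \ ball 0 r₁

/-- The calibrating field of `shell d r₁ r₂`. -/
def shellField (d : ℕ) (r₁ r₂ : ℝ) (x : EuclideanSpace ℝ (Fin d)) : EuclideanSpace ℝ (Fin d) :=
  shellProfile d r₁ r₂ ‖x‖ • x

lemma mem_shell : x ∈ shell d r₁ r₂ ↔ r₁ ≤ ‖x‖ ∧ ‖x‖ < r₂ := by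
  simp [shell, and_comm]

lemma annulus_eq_shell (r₁ r₂ : ℝ) : annulus r₁ r₂ = shell 2 r₁ r₂ := rfl

lemma measurableSet_shell : MeasurableSet (shell d r₁ r₂) :=
  measurableSet_ball.diff measurableSet_ball

lemma volume_real_shell (hd : d ≠ 0) (hr₁ : 0 ≤ r₁) (hr : r₁ < r₂) :
    volume.real (shell d r₁ r₂)
      = (r₂ ^ d - r₁ ^ d) * volume.real (ball (0 : EuclideanSpace ℝ (Fin d)) 1) := by
  have : Nonempty (Fin d) := Fin.pos_iff_nonempty.1 (Nat.pos_of_ne_zero hd)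
  have volume_real_ball {r : ℝ} (h : 0 ≤ r) :
      volume.real (ball (0 : EuclideanSpace ℝ (Fin d)) r)
        = r ^ d * volume.real (ball (0 : EuclideanSpace ℝ (Fin d)) 1) := by
    simp [measureReal_def, Measure.addHaar_ball _ _ h, h]
  rw [shell, measureReal_sdiff (ball_subset_ball hr.le) measurableSet_ball, volume_real_ball hr₁,
    volume_real_ball (hr₁.trans hr.le), sub_mul]

lemma perimeter_shell_le (hr₁ : 0 ≤ r₁) (hr : r₁ < r₂) :
    perimeter (shell d r₁ r₂) ≤ ENNReal.ofReal (d * (r₁ ^ (d - 1) + r₂ ^ (d - 1))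
      * volume.real (ball (0 : EuclideanSpace ℝ (Fin d)) 1)) := by
  have hr₂ : 0 ≤ r₂ := hr₁.trans hr.le
  calc perimeter (shell d r₁ r₂)
      ≤ perimeter (ball (0 : EuclideanSpace ℝ (Fin d)) r₂)
          + perimeter (ball (0 : EuclideanSpace ℝ (Fin d)) r₁) :=
        perimeter_sdiff_le measurableSet_ball measurableSet_ball (ball_subset_ball hr.le)
    _ ≤ ENNReal.ofReal (d * r₂ ^ (d - 1)) * volume (ball (0 : EuclideanSpace ℝ (Fin d)) 1)
          + ENNReal.ofReal (d * r₁ ^ (d - 1)) * volume (ball (0 : EuclideanSpace ℝ (Fin d)) 1) :=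
        add_le_add (perimeter_ball_le hr₂) (perimeter_ball_le hr₁)
    _ = _ := by
        rw [← add_mul, ← ENNReal.ofReal_add (by positivity) (by positivity), ← mul_add, add_comm,
          ENNReal.ofReal_mul (p := d * _) (by positivity), ofReal_measureReal]

lemma finitePerimeter_shell (hr₁ : 0 ≤ r₁) (hr : r₁ < r₂) : FinitePerimeter (shell d r₁ r₂) :=
  ⟨measurableSet_shell, (perimeter_shell_le hr₁ hr).trans_lt ENNReal.ofReal_lt_top⟩

lemma norm_shellField_le_one (hd : d ≠ 0) (hr₁ : 0 ≤ r₁) (hr : r₁ < r₂)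
    (x : EuclideanSpace ℝ (Fin d)) : ‖shellField d r₁ r₂ x‖ ≤ 1 := by
  rw [shellField, norm_smul, Real.norm_eq_abs, ← abs_norm x, ← abs_mul, abs_norm]
  exact abs_shellProfile_mul_le_one hd hr₁ hr (norm_nonneg x)

lemma exists_lipschitzWith_shellField (hd : 2 ≤ d) (hr₁ : 0 ≤ r₁) (hr : r₁ < r₂) :
    ∃ C, LipschitzWith C (shellField d r₁ r₂) := by
  have hr₂ : 0 < r₂ := hr₁.trans_lt hr
  obtain ⟨C, hC⟩ := exists_lipschitzWith_max_norm_pow_inv_smul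
    (V := EuclideanSpace ℝ (Fin d)) hr₂ (d + 2)
  obtain ⟨C₂, hC₂⟩ := exists_lipschitzWith_max_norm_pow_inv_smul
    (V := EuclideanSpace ℝ (Fin d)) hr₂ d
  obtain ⟨C₁, hC₁⟩ : ∃ C₁, LipschitzWith C₁ fun x : EuclideanSpace ℝ (Fin d) =>
      shellFlux d r₁ r₂ • (max r₁ ‖x‖ ^ d)⁻¹ • x := by
    obtain rfl | hr₁ := hr₁.eq_or_lt
    · have flux_eq_zero : shellFlux d 0 r₂ = 0 := by
        rw [shellFlux, zero_pow (by lia), zero_mul]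
      simp only [flux_eq_zero, zero_smul]
      exact ⟨0, .const 0⟩
    · obtain ⟨C₁, hC₁⟩ := exists_lipschitzWith_max_norm_pow_inv_smul
        (V := EuclideanSpace ℝ (Fin d)) hr₁ d
      exact ⟨_, (lipschitzWith_smul _).comp hC₁⟩
  have decomposition : shellField d r₁ r₂ = fun x =>
      r₂ ^ (d + 1) • (max r₂ ‖x‖ ^ (d + 2))⁻¹ • x
        + (shellFlux d r₁ r₂ • (max r₂ ‖x‖ ^ d)⁻¹ • x
          - shellFlux d r₁ r₂ • (max r₁ ‖x‖ ^ d)⁻¹ • x) := by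
    funext x
    rw [shellField, shellProfile]
    module
  rw [decomposition]
  exact ⟨_, ((lipschitzWith_smul _).comp hC).add (((lipschitzWith_smul _).comp hC₂).sub hC₁)⟩

lemma divergence_shellField_of_lt_left (hd : d ≠ 0) (hr : r₁ < r₂) (hx : x ≠ 0) (h : ‖x‖ < r₁) :
    divergence (shellField d r₁ r₂) x = -(d * r₁⁻¹) := by
  have hr₁ : 0 < r₁ := (norm_nonneg x).trans_lt h
  have profile_eq : shellProfile d r₁ r₂ =ᶠ[𝓝 ‖x‖] fun r => -r₁⁻¹ + 0 * (r ^ 0)⁻¹ := by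
    filter_upwards [Iio_mem_nhds h] with r hrr
    rw [shellProfile_of_le_left hd hr₁ hr (le_of_lt hrr), zero_mul, add_zero]
  simpa using! divergence_radial_of_eventuallyEq hx profile_eq

lemma divergence_shellField_of_mem_Ioo (hd : d ≠ 0) (hr₁ : 0 ≤ r₁) (h : ‖x‖ ∈ Ioo r₁ r₂) :
    divergence (shellField d r₁ r₂) x = d * shellSlope d r₁ r₂ := by
  have hx : x ≠ 0 := norm_pos_iff.1 (hr₁.trans_lt h.1)
  have profile_eq : shellProfile d r₁ r₂ =ᶠ[𝓝 ‖x‖]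
      fun r => shellSlope d r₁ r₂ + -shellFlux d r₁ r₂ * (r ^ d)⁻¹ := by
    filter_upwards [isOpen_Ioo.mem_nhds h] with r hrr
    exact shellProfile_of_mem_Icc hd hr₁ (h.1.trans h.2) (Ioo_subset_Icc_self hrr)
  simpa using! divergence_radial_of_eventuallyEq hx profile_eq

lemma divergence_shellField_of_right_lt (hr₁ : 0 ≤ r₁) (hr : r₁ < r₂) (h : r₂ < ‖x‖) :
    divergence (shellField d r₁ r₂) x = -(2 * r₂ ^ (d + 1) * (‖x‖ ^ (d + 2))⁻¹) := by
  have hx : x ≠ 0 := norm_pos_iff.1 ((hr₁.trans_lt hr).trans h)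
  have profile_eq : shellProfile d r₁ r₂ =ᶠ[𝓝 ‖x‖]
      fun r => 0 + r₂ ^ (d + 1) * (r ^ (d + 2))⁻¹ := by
    filter_upwards [Ioi_mem_nhds h] with r hrr
    rw [shellProfile_of_right_le hr (le_of_lt hrr), zero_add]
  simpa using! divergence_radial_of_eventuallyEq hx profile_eq

lemma integrable_shellField (hd : 2 ≤ d) (hr₁ : 0 ≤ r₁) (hr : r₁ < r₂) :
    Integrable (shellField d r₁ r₂) := by
  have hr₂ : 0 < r₂ := hr₁.trans_lt hr
  obtain ⟨C, hC⟩ := exists_lipschitzWith_shellField hd hr₁ hr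
  refine integrable_of_norm_le_of_norm_le_div_pow (k := d + 1) (C := r₂ ^ (d + 1)) (by simp) hr₂
    hC.continuous.aestronglyMeasurable
    (.of_forall (norm_shellField_le_one (by lia) hr₁ hr)) (.of_forall fun x hx => ?_)
  have norm_pos : 0 < ‖x‖ := hr₂.trans hx
  rw [shellField, shellProfile_of_right_le hr hx.le, norm_smul,
    Real.norm_of_nonneg (by positivity)]
  field_simp
  exact (pow_succ' _ _).ge

lemma integrable_divergence_shellField (hd : 2 ≤ d) (hr₁ : 0 ≤ r₁) (hr : r₁ < r₂) :
    Integrable (divergence (shellField d r₁ r₂)) := by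
  have hr₂ : 0 < r₂ := hr₁.trans_lt hr
  obtain ⟨C, hC⟩ := exists_lipschitzWith_shellField hd hr₁ hr
  refine integrable_of_norm_le_of_norm_le_div_pow (k := d + 2) (C := 2 * r₂ ^ (d + 1)) (by simp)
    hr₂ measurable_divergence.aestronglyMeasurable (.of_forall (norm_divergence_le hC))
    (.of_forall fun x hx => ?_)
  rw [divergence_shellField_of_right_lt hr₁ hr hx, norm_neg, Real.norm_of_nonneg (by positivity)]

lemma ae_norm_ne {V : Type*} [NormedAddCommGroup V] [NormedSpace ℝ V] [FiniteDimensional ℝ V]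
    [MeasurableSpace V] [BorelSpace V] [Nontrivial V] (μ : Measure V) [μ.IsAddHaarMeasure] (r : ℝ) :
    ∀ᵐ x ∂μ, ‖x‖ ≠ r := by
  filter_upwards [compl_mem_ae_iff.2 (Measure.addHaar_sphere μ 0 r)] with x hx hxr
  exact hx (by simpa using hxr)

lemma ae_divergence_shellField_eq (hd : d ≠ 0) (hr₁ : 0 ≤ r₁) :
    ∀ᵐ x ∂volume.restrict (shell d r₁ r₂),
      divergence (shellField d r₁ r₂) x = d * shellSlope d r₁ r₂ := by
  have : Nonempty (Fin d) := Fin.pos_iff_nonempty.1 (Nat.pos_of_ne_zero hd)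
  filter_upwards [ae_restrict_mem measurableSet_shell, ae_restrict_of_ae (ae_norm_ne volume r₁)]
    with x hx hx₁
  obtain ⟨hle, hlt⟩ := mem_shell.1 hx
  exact divergence_shellField_of_mem_Ioo hd hr₁ ⟨hle.lt_of_ne' hx₁, hlt⟩

lemma ae_divergence_shellField_neg (hd : d ≠ 0) (hr₁ : 0 ≤ r₁) (hr : r₁ < r₂) :
    ∀ᵐ x ∂volume.restrict (shell d r₁ r₂)ᶜ, divergence (shellField d r₁ r₂) x < 0 := by
  have : Nonempty (Fin d) := Fin.pos_iff_nonempty.1 (Nat.pos_of_ne_zero hd)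
  have hr₂ : 0 < r₂ := hr₁.trans_lt hr
  filter_upwards [ae_restrict_mem measurableSet_shell.compl,
    ae_restrict_of_ae (ae_norm_ne volume 0), ae_restrict_of_ae (ae_norm_ne volume r₂)]
    with x hx hx₀ hx₂
  rcases lt_or_ge ‖x‖ r₁ with h | h
  · have hr₁ : 0 < r₁ := (norm_nonneg x).trans_lt h
    rw [divergence_shellField_of_lt_left hd hr (norm_ne_zero_iff.1 hx₀) h, neg_lt_zero]
    positivity
  · have hlt : r₂ < ‖x‖ := (not_lt.1 fun h' => hx (mem_shell.2 ⟨h, h'⟩)).lt_of_ne' hx₂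
    rw [divergence_shellField_of_right_lt hr₁ hr hlt, neg_lt_zero]
    positivity

theorem isCalibratedBy_shell (hd : 2 ≤ d) (hr₁ : 0 ≤ r₁) (hr : r₁ < r₂) :
    IsCalibratedBy (shell d r₁ r₂) (divergence (shellField d r₁ r₂)) := by
  have hd' : d ≠ 0 := by lia
  have hr₂ : 0 ≤ r₂ := hr₁.trans hr.le
  obtain ⟨C, hC⟩ := exists_lipschitzWith_shellField hd hr₁ hr
  have integrable := integrable_divergence_shellField hd hr₁ hr
  have abs_le (F : Set (EuclideanSpace ℝ (Fin d))) (hF : FinitePerimeter F) :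
      |∫ x in F, divergence (shellField d r₁ r₂) x| ≤ (perimeter F).toReal :=
    abs_setIntegral_divergence_le hF hC (norm_shellField_le_one hd' hr₁ hr)
      (integrable_shellField hd hr₁ hr) integrable
  have pow_sub_ne : r₂ ^ d - r₁ ^ d ≠ 0 := (sub_pos.2 (pow_lt_pow_left₀ hr hr₁ hd')).ne'
  have integral_eq : ∫ x in shell d r₁ r₂, divergence (shellField d r₁ r₂) x
      = d * (r₁ ^ (d - 1) + r₂ ^ (d - 1))
        * volume.real (ball (0 : EuclideanSpace ℝ (Fin d)) 1) := by
    rw [integral_congr_ae (ae_divergence_shellField_eq hd' hr₁), setIntegral_const,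
      volume_real_shell hd' hr₁ hr, shellSlope, smul_eq_mul]
    field_simp
  refine ⟨integrable, finitePerimeter_shell hr₁ hr, abs_le, ?_⟩
  refine ((le_abs_self _).trans (abs_le _ (finitePerimeter_shell hr₁ hr))).antisymm ?_
  rw [integral_eq]
  exact ENNReal.toReal_le_of_le_ofReal (by positivity) (perimeter_shell_le hr₁ hr)

end Shell

end VarCurv

end

theorem mainTheorem12_general {d : ℕ} (hd : 2 ≤ d) (r₁ r₂ : ℝ) (hr₁ : 0 ≤ r₁) (hr : r₁ < r₂) :
    (∃ h κ : EuclideanSpace ℝ (Fin d) → ℝ,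
      VarCurv.IsDensity h ∧
      (∀ᵐ x ∂(volume.restrict (VarCurv.shell d r₁ r₂)), h x = 1) ∧
      VarCurv.IsOptimalCurvature h (VarCurv.shell d r₁ r₂) κ ∧
      VarCurv.IsVariationalCurvature (VarCurv.shell d r₁ r₂) κ ∧
      ∀ κ' : EuclideanSpace ℝ (Fin d) → ℝ,
        VarCurv.IsVariationalCurvature (VarCurv.shell d r₁ r₂) κ' →
          ∫ x, ‖κ x‖ ≤ ∫ x, ‖κ' x‖) ∧
    ∀ h κ : EuclideanSpace ℝ (Fin d) → ℝ,
      VarCurv.IsDensity h →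
      (∀ᵐ x ∂(volume.restrict (VarCurv.shell d r₁ r₂)), h x = 1) →
      VarCurv.IsOptimalCurvature h (VarCurv.shell d r₁ r₂) κ →
        ∀ᵐ x ∂(volume.restrict (VarCurv.shell d r₁ r₂)),
          κ x = d * (r₁ ^ (d - 1) + r₂ ^ (d - 1)) / (r₂ ^ d - r₁ ^ d) := by
  have hd' : d ≠ 0 := by lia
  have calibrated := VarCurv.isCalibratedBy_shell hd hr₁ hr
  have curvature_pos : 0 < d * VarCurv.shellSlope d r₁ r₂ :=
    mul_pos (by positivity) (VarCurv.shellSlope_pos hd' hr₁ hr)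
  have curvature_inside := VarCurv.ae_divergence_shellField_eq (r₂ := r₂) hd' hr₁
  have curvature_outside := VarCurv.ae_divergence_shellField_neg hd' hr₁ hr
  refine ⟨calibrated.exists_isOptimalCurvature curvature_pos curvature_inside curvature_outside,
    fun h κ hh hh1 hκ => ?_⟩
  rw [mul_div_assoc]
  exact calibrated.ae_eq_of_isOptimalCurvature curvature_pos curvature_inside hh hh1 hκ

/-- First part: an optimal curvature of the annulus whose density is one on the annulus exists, and
it can be taken to be a variational mean curvature with least `L¹` norm. Second part: every optimal
curvature whose density is one on the annulus has the stated constant value on the annulus. -/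
theorem mainTheorem12 (r₁ r₂ : ℝ) (hr₁ : 0 ≤ r₁) (hr : r₁ < r₂) :
    (∃ h κ : EuclideanSpace ℝ (Fin 2) → ℝ,
      VarCurv.IsDensity h ∧
      (∀ᵐ x ∂(volume.restrict (VarCurv.annulus r₁ r₂)), h x = 1) ∧
      VarCurv.IsOptimalCurvature h (VarCurv.annulus r₁ r₂) κ ∧
      VarCurv.IsVariationalCurvature (VarCurv.annulus r₁ r₂) κ ∧
      ∀ κ' : EuclideanSpace ℝ (Fin 2) → ℝ,
        VarCurv.IsVariationalCurvature (VarCurv.annulus r₁ r₂) κ' →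
          ∫ x, ‖κ x‖ ≤ ∫ x, ‖κ' x‖) ∧
    ∀ h κ : EuclideanSpace ℝ (Fin 2) → ℝ,
      VarCurv.IsDensity h →
      (∀ᵐ x ∂(volume.restrict (VarCurv.annulus r₁ r₂)), h x = 1) →
      VarCurv.IsOptimalCurvature h (VarCurv.annulus r₁ r₂) κ →
        ∀ᵐ x ∂(volume.restrict (VarCurv.annulus r₁ r₂)),
          κ x = 2 * (r₁ + r₂) / (r₂ ^ 2 - r₁ ^ 2) := by
  simpa [VarCurv.annulus_eq_shell] using mainTheorem12_general le_rfl r₁ r₂ hr₁ hr
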